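/- Let $\theta\in\mathbb{R}$ and $s_1>0$. Let $\hat\theta_1\sim N(\theta,s_1^2)$ and $\hat\theta_2\sim N(\theta+b_2,s_2^2)$ be random variables on a common probability space (with arbitrary dependence), where $b_2\in\mathbb{R}$, $s_2\ge 0$ (with $N(m,0)$ the point mass at $m$), and the two estimators of $\theta$ have equal mean squared error: $b_2^2+s_2^2=s_1^2$. For $0<\alpha<1$ let $z_{1-\alpha/2}$ be the $(1-\alpha/2)$-quantile of the standard normal distribution, and put $$\mathrm{CI}_1=[\hat\theta_1- z_{1-\alpha/2}s_1,\ \hat\theta_1+ z_{1-\alpha/2}s_1],\qquad \mathrm{CI}_2=[\hat\theta_2- z_{1-\alpha/2}s_1,\ \hat\theta_2+ z_{1-\alpha/2}s_1].$$ The coverage probability of $\mathrm{CI}_i$ is $\Pr(\theta\in\mathrm{CI}_i)$. Then: 1. For every $0<\alpha<1$, the coverage probability of $\mathrm{CI}_1$ equals $1-\alpha$. 2. For every $\alpha>0$ with $1-\alpha\ge 0.917$, the coverage probability of $\mathrm{CI}_2$ is strictly greater than $1-\alpha$ whenever $b_2\neq 0$. 3. For $1-\alpha=0.9$ and any $b_2$,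 the coverage probability of $\mathrm{CI}_2$ is at least $0.89995$ (that is, at least $90.00\%$ after rounding). 4. For $1-\alpha=0.9$, with $\theta$ and $s_1$ fixed, the coverage probability of $\mathrm{CI}_2$ tends to $1$ as $|b_2|\to s_1$, and it is strictly increasing in $|b_2|$ for $|b_2|$ close enough to $s_1$: there is $\beta<s_1$ such that it is strictly increasing in $|b_2|$ on $[\beta,s_1]$. -/

import Mathlib

open MeasureTheory ProbabilityTheory Filter Topology

/-- The `p`-quantile of a probability distribution on the real line. -/
noncomputable def quantile (μ : Measure ℝ) (p : ℝ) : ℝ :=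
  sInf {x : ℝ | p ≤ cdf μ x}

/-- The critical value `z_p`: the `p`-quantile of the standard normal distribution. -/
noncomputable def zCrit (p : ℝ) : ℝ :=
  quantile (gaussianReal 0 1) p

/-- The normal distribution with mean `m` and standard deviation `s`
(a point mass at `m` if `s = 0`). -/
noncomputable def normalDist (m s : ℝ) : Measure ℝ :=
  gaussianReal m (s ^ 2).toNNReal

/-- The probability that the random set `CI` contains the parameter value `θ`. -/
noncomputable def coverageProb {Ω : Type*} [MeasurableSpace Ω] (P : Measure Ω)
    (CI : Ω → Set ℝ) (θ : ℝ) : ℝ :=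
  P.real {ω | θ ∈ CI ω}

universe u

/-- Two estimators of `θ`, on a common probability space and with arbitrary dependence:
`est₁ ∼ N(θ, s₁²)` is unbiased, `est₂ ∼ N(θ + b₂, s₂²)` has bias `b₂`, and their mean squared
errors `s₁²` and `b₂² + s₂²` are equal. -/
structure EqualMSEModel (θ s₁ : ℝ) where
  Ω : Type u
  [mΩ : MeasurableSpace Ω]
  P : Measure Ω
  [prob : IsProbabilityMeasure P]
  est₁ : Ω → ℝ
  est₂ : Ω → ℝ
  b₂ : ℝ
  s₂ : ℝ
  s₂_nonneg : 0 ≤ s₂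
  law₁ : HasLaw est₁ (normalDist θ s₁) P
  law₂ : HasLaw est₂ (normalDist (θ + b₂) s₂) P
  equal_mse : b₂ ^ 2 + s₂ ^ 2 = s₁ ^ 2

attribute [instance] EqualMSEModel.mΩ EqualMSEModel.prob

namespace EqualMSEModel

variable {θ s₁ : ℝ}

/-- `CI₁ = est₁ ± z_{1-α/2} s₁`. -/
noncomputable def CI₁ (M : EqualMSEModel.{u} θ s₁) (α : ℝ) (ω : M.Ω) : Set ℝ :=
  Set.Icc (M.est₁ ω - zCrit (1 - α / 2) * s₁) (M.est₁ ω + zCrit (1 - α / 2) * s₁)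

/-- `CI₂ = est₂ ± z_{1-α/2} s₁`: centred at the biased estimator, with the standard error of the
unbiased one. -/
noncomputable def CI₂ (M : EqualMSEModel.{u} θ s₁) (α : ℝ) (ω : M.Ω) : Set ℝ :=
  Set.Icc (M.est₂ ω - zCrit (1 - α / 2) * s₁) (M.est₂ ω + zCrit (1 - α / 2) * s₁)

/-- Coverage probability of `CI₁` at nominal level `1 - α`. -/
noncomputable def CP₁ (M : EqualMSEModel.{u} θ s₁) (α : ℝ) : ℝ :=
  coverageProb M.P (M.CI₁ α) θ

/-- Coverage probability of `CI₂` at nominal level `1 - α`. -/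
noncomputable def CP₂ (M : EqualMSEModel.{u} θ s₁) (α : ℝ) : ℝ :=
  coverageProb M.P (M.CI₂ α) θ

end EqualMSEModel

/-!
With `|b₂| / s₂ = sinh t` and `s₁ / s₂ = cosh t`, the coverage probability of `CI₂` is
`Φ (z cosh t + sinh t) + Φ (z cosh t - sinh t) - 1`. Its derivative in `t` is a positive multiple of
`z sinh t cosh y - cosh t sinh y`, where `y = z sinh t cosh t`. This is positive as soon as
`cosh t ≤ z sinh t`, that is `s₁ / z ≤ |b₂|`; for smaller `t` its power series in `y` is bounded
below by its first three terms, whose sum is positive if `z² ≥ 3`. For `z ≥ 1.6448` the derivative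
is negative at most where `sinh² t ≤ 0.1418`, and integrating a polynomial lower bound for it shows
that the coverage falls by at most `0.00005` there. The limit `|b₂| → s₁` is Chebyshev's inequality,
since the variance `s₁² - b₂²` of the second estimator vanishes in that limit.
-/

open Real

local notation "Φ" => cdf (gaussianReal 0 1)

local notation "φ" => gaussianPDFReal 0 1

section CumulativeDistribution

variable {μ : Measure ℝ}

lemma cdf_quantile (hμ : Continuous (cdf μ)) {p : ℝ} (hp₀ : 0 < p) (hp₁ : p < 1) :
    cdf μ (quantile μ p) = p := by
  obtain ⟨x, hx⟩ : p ∈ Set.range (cdf μ) := mem_range_of_exists_le_of_exists_ge hμ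
    ((tendsto_cdf_atBot μ).eventually_le_const hp₀).exists
    ((tendsto_cdf_atTop μ).eventually_const_le hp₁).exists
  obtain ⟨y, hy⟩ := ((tendsto_cdf_atBot μ).eventually_lt_const hp₀).exists
  have hbdd : BddBelow {x | p ≤ cdf μ x} :=
    ⟨y, fun w hw => ((monotone_cdf μ).reflect_lt (hy.trans_le hw)).le⟩
  have hclosed : IsClosed {x | p ≤ cdf μ x} := isClosed_le continuous_const hμ
  exact le_antisymm ((monotone_cdf μ (csInf_le hbdd hx.ge)).trans hx.le)
    (hclosed.csInf_mem ⟨x, hx.ge⟩ hbdd)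

lemma lt_quantile_of_cdf_lt (hμ : Continuous (cdf μ)) {a p : ℝ} (ha : cdf μ a < p) (hp : p < 1) :
    a < quantile μ p :=
  (monotone_cdf μ).reflect_lt <| by rwa [cdf_quantile hμ ((cdf_nonneg μ a).trans_lt ha) hp]

variable [IsProbabilityMeasure μ] [NullSingletonClass μ]

lemma measureReal_Icc_eq_cdf_sub {a b : ℝ} (hab : a ≤ b) :
    μ.real (Set.Icc a b) = cdf μ b - cdf μ a := by
  rw [cdf_eq_real, cdf_eq_real,
    ← measureReal_sdiff (Set.Iic_subset_Iic.2 hab) measurableSet_Iic, Set.Iic_sdiff_Iic]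
  exact measureReal_congr Ioc_ae_eq_Icc.symm

lemma cdf_neg_of_map_neg_eq (hμ : μ.map (fun x => -x) = μ) (x : ℝ) :
    cdf μ (-x) = 1 - cdf μ x := by
  calc cdf μ (-x) = (μ.map fun x => -x).real (Set.Iic (-x)) := by rw [hμ, cdf_eq_real]
    _ = μ.real (Set.Ici x) := by
      rw [map_measureReal_apply measurable_neg measurableSet_Iic]
      simp only [Set.neg_preimage, Set.neg_Iic, neg_neg]
    _ = μ.real (Set.Ioi x) := measureReal_congr Ioi_ae_eq_Ici.symm
    _ = 1 - cdf μ x := by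
      rw [← Set.compl_Iic, probReal_compl_eq_one_sub measurableSet_Iic, cdf_eq_real]

lemma coverageProb_Icc_eq_cdf_sub {Ω : Type*} [MeasurableSpace Ω] {P : Measure Ω} {X : Ω → ℝ}
    (hX : HasLaw X μ P) (θ : ℝ) {c : ℝ} (hc : 0 ≤ c) :
    coverageProb P (fun ω => Set.Icc (X ω - c) (X ω + c)) θ = cdf μ (θ + c) - cdf μ (θ - c) := by
  have hmem (x : ℝ) : θ ∈ Set.Icc (x - c) (x + c) ↔ x ∈ Set.Icc (θ - c) (θ + c) := by
    rw [← Set.mem_Icc_iff_abs_le, ← Set.mem_Icc_iff_abs_le, abs_sub_comm]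
  simp only [coverageProb, hmem]
  rw [hX.measureReal_eq (p := (· ∈ Set.Icc (θ - c) (θ + c))) measurableSet_Icc]
  exact measureReal_Icc_eq_cdf_sub (by linarith)

end CumulativeDistribution

lemma one_sub_variance_div_sq_le_coverageProb {Ω : Type*} [MeasurableSpace Ω] {P : Measure Ω}
    [IsProbabilityMeasure P] {X : Ω → ℝ} (hX : MemLp X 2 P) {θ c : ℝ} (hc : |P[X] - θ| < c) :
    1 - Var[X; P] / (c - |P[X] - θ|) ^ 2 ≤
      coverageProb P (fun ω => Set.Icc (X ω - c) (X ω + c)) θ := by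
  have hd : 0 < c - |P[X] - θ| := sub_pos.2 hc
  have hchebyshev : P.real {ω | c - |P[X] - θ| ≤ |X ω - P[X]|} ≤
      Var[X; P] / (c - |P[X] - θ|) ^ 2 :=
    ENNReal.toReal_le_of_le_ofReal (div_nonneg (variance_nonneg X P) (sq_nonneg _))
      (meas_ge_le_variance_div_sq hX hd)
  have hcover : Set.univ ⊆ {ω | θ ∈ Set.Icc (X ω - c) (X ω + c)} ∪
      {ω | c - |P[X] - θ| ≤ |X ω - P[X]|} := by
    intro ω _
    refine or_iff_not_imp_right.2 fun hω => Set.mem_Icc_iff_abs_le.1 ?_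
    rw [Set.mem_ofPred_eq, not_le] at hω
    linarith [abs_sub_le (X ω) P[X] θ]
  have hunion := (measureReal_mono (μ := P) hcover).trans (measureReal_union_le _ _)
  rw [probReal_univ] at hunion
  unfold coverageProb
  linarith

section Gaussian

variable (m : ℝ) {v : NNReal}

lemma continuous_gaussianPDFReal (v : NNReal) : Continuous (gaussianPDFReal m v) := by
  unfold gaussianPDFReal
  fun_prop

lemma cdf_gaussianReal_sub_cdf (hv : v ≠ 0) (a b : ℝ) :
    cdf (gaussianReal m v) b - cdf (gaussianReal m v) a = ∫ t in a..b, gaussianPDFReal m v t := by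
  wlog hab : a ≤ b generalizing a b
  · rw [intervalIntegral.integral_symm, ← this b a (le_of_not_ge hab), neg_sub]
  have := nullSingletonClass_gaussianReal (μ := m) hv
  rw [← measureReal_Icc_eq_cdf_sub hab, Measure.real, gaussianReal_apply_eq_integral m hv,
    ENNReal.toReal_ofReal (integral_nonneg fun x => gaussianPDFReal_nonneg m v x),
    integral_Icc_eq_integral_Ioc, ← intervalIntegral.integral_of_le hab]

lemma hasDerivAt_cdf_gaussianReal (hv : v ≠ 0) (x : ℝ) :
    HasDerivAt (cdf (gaussianReal m v)) (gaussianPDFReal m v x) x := by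
  have hcdf : (cdf (gaussianReal m v) : ℝ → ℝ) =
      fun x => cdf (gaussianReal m v) 0 + ∫ t in (0 : ℝ)..x, gaussianPDFReal m v t := by
    ext x
    rw [← cdf_gaussianReal_sub_cdf m hv, add_sub_cancel]
  have hpdf := continuous_gaussianPDFReal m v
  rw [hcdf]
  exact (intervalIntegral.integral_hasDerivAt_right (hpdf.intervalIntegrable _ _)
    (hpdf.stronglyMeasurableAtFilter _ _) hpdf.continuousAt).const_add _

lemma continuous_cdf_gaussianReal (hv : v ≠ 0) : Continuous (cdf (gaussianReal m v)) :=
  continuous_iff_continuousAt.2 fun x => (hasDerivAt_cdf_gaussianReal m hv x).continuousAt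

lemma cdf_gaussianReal_lt_one (hv : v ≠ 0) (x : ℝ) : cdf (gaussianReal m v) x < 1 := by
  have hmono : StrictMono (cdf (gaussianReal m v)) := strictMono_of_deriv_pos fun x => by
    rw [(hasDerivAt_cdf_gaussianReal m hv x).deriv]
    exact gaussianPDFReal_pos m v x hv
  exact (hmono (lt_add_one x)).trans_le (cdf_le_one _ _)

end Gaussian

lemma cdf_stdNormal_neg (x : ℝ) : Φ (-x) = 1 - Φ x := by
  have := nullSingletonClass_gaussianReal (μ := 0) (v := 1) one_ne_zero
  exact cdf_neg_of_map_neg_eq (by rw [gaussianReal_map_neg, neg_zero]) x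

lemma cdf_stdNormal_zero : Φ 0 = 1 / 2 := by
  have h := cdf_stdNormal_neg 0
  rw [neg_zero] at h
  linarith

lemma stdNormalPDF_eq (x : ℝ) : φ x = (√(2 * π))⁻¹ * exp (-x ^ 2 / 2) := by
  simp [gaussianPDFReal]

instance isProbabilityMeasure_normalDist (m s : ℝ) : IsProbabilityMeasure (normalDist m s) :=
  inferInstanceAs (IsProbabilityMeasure (gaussianReal _ _))

lemma nullSingletonClass_normalDist (m : ℝ) {s : ℝ} (hs : 0 < s) :
    NullSingletonClass (normalDist m s) :=
  nullSingletonClass_gaussianReal (Real.toNNReal_pos.2 (by positivity)).ne'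

lemma normalDist_eq_map (m s : ℝ) :
    normalDist m s = (gaussianReal 0 1).map fun x => m + s * x := by
  rw [← Function.comp_def (fun x => m + x) (fun x => s * x),
    ← Measure.map_map (by fun_prop) (by fun_prop), gaussianReal_map_const_mul,
    gaussianReal_map_const_add, normalDist, mul_zero, zero_add, mul_one,
    Real.toNNReal_of_nonneg (sq_nonneg s)]

lemma cdf_normalDist (m : ℝ) {s : ℝ} (hs : 0 < s) (x : ℝ) :
    cdf (normalDist m s) x = Φ ((x - m) / s) := by
  rw [cdf_eq_real, cdf_eq_real, normalDist_eq_map,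
    map_measureReal_apply (by fun_prop) measurableSet_Iic]
  congr 1
  ext y
  rw [Set.mem_preimage, Set.mem_Iic, Set.mem_Iic, le_div_iff₀ hs, le_sub_iff_add_le', mul_comm]

lemma coverageProb_Icc_of_normalDist {Ω : Type*} [MeasurableSpace Ω] {P : Measure Ω} {X : Ω → ℝ}
    {m s c : ℝ} (hX : HasLaw X (normalDist m s) P) (hs : 0 < s) (hc : 0 ≤ c) (θ : ℝ) :
    coverageProb P (fun ω => Set.Icc (X ω - c) (X ω + c)) θ =
      Φ ((c + (m - θ)) / s) + Φ ((c - (m - θ)) / s) - 1 := by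
  have := nullSingletonClass_normalDist m hs
  have hneg : Φ ((θ - c - m) / s) = 1 - Φ ((c + (m - θ)) / s) := by
    rw [← cdf_stdNormal_neg]
    ring_nf
  rw [coverageProb_Icc_eq_cdf_sub hX θ hc, cdf_normalDist m hs, cdf_normalDist m hs, hneg]
  ring_nf

lemma hasDerivAt_exp_sub_sum (n : ℕ) (x : ℝ) :
    HasDerivAt (fun x => exp x - ∑ k ∈ Finset.range (n + 1), x ^ k / (k.factorial : ℝ))
      (exp x - ∑ k ∈ Finset.range n, x ^ k / (k.factorial : ℝ)) x := by
  simp only [Finset.sum_range_succ', pow_zero]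
  refine (hasDerivAt_exp x).sub (.add_const _ (.fun_sum fun k _ => ?_))
  refine ((hasDerivAt_pow (k + 1) x).div_const _).congr_deriv ?_
  rw [Nat.factorial_succ, Nat.add_sub_cancel]
  push_cast
  field_simp

lemma neg_one_pow_mul_exp_sub_sum_nonneg (n : ℕ) {x : ℝ} (hx : x ≤ 0) :
    0 ≤ (-1) ^ n * (exp x - ∑ k ∈ Finset.range n, x ^ k / (k.factorial : ℝ)) := by
  induction n generalizing x with
  | zero => simpa using (exp_pos x).le
  | succ n ih =>
    have hderiv (y : ℝ) := (hasDerivAt_exp_sub_sum n y).const_mul ((-1) ^ (n + 1))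
    have hanti : AntitoneOn (fun y => (-1) ^ (n + 1) *
        (exp y - ∑ k ∈ Finset.range (n + 1), y ^ k / (k.factorial : ℝ))) (Set.Iic 0) := by
      refine antitoneOn_of_hasDerivWithinAt_nonpos (convex_Iic 0)
        (fun y _ => (hderiv y).continuousAt.continuousWithinAt)
        (fun y _ => (hderiv y).hasDerivWithinAt) fun y hy => ?_
      rw [pow_succ, mul_neg_one, neg_mul, neg_nonpos]
      exact ih (interior_subset (s := Set.Iic 0) hy)
    have h := hanti hx Set.self_mem_Iic hx
    simpa [Finset.sum_range_succ'] using h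

lemma exp_le_sum_of_odd {n : ℕ} (hn : Odd n) {x : ℝ} (hx : x ≤ 0) :
    exp x ≤ ∑ k ∈ Finset.range n, x ^ k / (k.factorial : ℝ) := by
  have h := neg_one_pow_mul_exp_sub_sum_nonneg n hx
  rw [hn.neg_one_pow] at h
  linarith

lemma cdf_stdNormal_le_sum {n : ℕ} (hn : Odd n) {a : ℝ} (ha : 0 ≤ a) :
    Φ a ≤ 1 / 2 + (√(2 * π))⁻¹ * ∑ k ∈ Finset.range n,
      (-1 / 2) ^ k * a ^ (2 * k + 1) / ((k.factorial : ℝ) * (2 * k + 1)) := by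
  have hpdf (t : ℝ) : φ t ≤ (√(2 * π))⁻¹ *
      ∑ k ∈ Finset.range n, (-1 / 2) ^ k / (k.factorial : ℝ) * t ^ (2 * k) := by
    rw [stdNormalPDF_eq]
    gcongr
    refine (exp_le_sum_of_odd hn (by linarith [sq_nonneg t])).trans_eq ?_
    refine Finset.sum_congr rfl fun k _ => ?_
    rw [pow_mul, show -t ^ 2 / 2 = -1 / 2 * t ^ 2 by ring, mul_pow]
    ring
  have hint : ∫ t in (0 : ℝ)..a, (√(2 * π))⁻¹ *
      ∑ k ∈ Finset.range n, (-1 / 2) ^ k / (k.factorial : ℝ) * t ^ (2 * k) =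
      (√(2 * π))⁻¹ * ∑ k ∈ Finset.range n,
        (-1 / 2) ^ k * a ^ (2 * k + 1) / ((k.factorial : ℝ) * (2 * k + 1)) := by
    rw [intervalIntegral.integral_const_mul, intervalIntegral.integral_finsetSum
      fun k _ => Continuous.intervalIntegrable (by fun_prop) _ _]
    congr 1
    refine Finset.sum_congr rfl fun k _ => ?_
    rw [intervalIntegral.integral_const_mul, integral_pow, zero_pow (Nat.succ_ne_zero _), sub_zero,
      div_mul_div_comm]
    push_cast
    rfl
  have hmono := intervalIntegral.integral_mono_on (μ := volume) ha
    ((continuous_gaussianPDFReal 0 1).intervalIntegrable _ _)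
    (Continuous.intervalIntegrable (by fun_prop) _ _) fun t _ => hpdf t
  rw [hint, ← cdf_gaussianReal_sub_cdf 0 one_ne_zero, cdf_stdNormal_zero] at hmono
  linarith

lemma lt_sqrt_two_pi : 2.50662 < √(2 * π) :=
  lt_sqrt_of_sq_lt (by linarith [pi_gt_d6])

lemma cdf_stdNormal_zCrit {α : ℝ} (hα₀ : 0 < α) (hα₁ : α < 1) :
    Φ (zCrit (1 - α / 2)) = 1 - α / 2 :=
  cdf_quantile (continuous_cdf_gaussianReal 0 one_ne_zero) (by linarith) (by linarith)

lemma zCrit_pos {α : ℝ} (hα₀ : 0 < α) (hα₁ : α < 1) : 0 < zCrit (1 - α / 2) :=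
  lt_quantile_of_cdf_lt (continuous_cdf_gaussianReal 0 one_ne_zero)
    (by linarith [cdf_stdNormal_zero]) (by linarith)

lemma lt_zCrit_of_sum_le {n : ℕ} (hn : Odd n) {a α : ℝ} (ha : 0 ≤ a) (hα₀ : 0 < α) (hα₁ : α < 1)
    (h : 2 * ∑ k ∈ Finset.range n,
      (-1 / 2) ^ k * a ^ (2 * k + 1) / ((k.factorial : ℝ) * (2 * k + 1)) ≤ 2.50662 * (1 - α)) :
    a < zCrit (1 - α / 2) := by
  refine lt_quantile_of_cdf_lt (continuous_cdf_gaussianReal 0 one_ne_zero) ?_ (by linarith)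
  refine (cdf_stdNormal_le_sum hn ha).trans_lt ?_
  rw [show 1 - α / 2 = 1 / 2 + (1 - α) / 2 by ring, add_lt_add_iff_left,
    inv_mul_lt_iff₀ (by positivity)]
  nlinarith [lt_sqrt_two_pi]

lemma one_lt_zCrit {α : ℝ} (hα₀ : 0 < α) (hα₁ : 0.683 ≤ 1 - α) : 1 < zCrit (1 - α / 2) := by
  refine lt_zCrit_of_sum_le (n := 9) (by decide) zero_le_one hα₀ (by linarith) ?_
  norm_num [Finset.sum_range_succ, Nat.factorial]
  linarith

lemma three_le_sq_zCrit {α : ℝ} (hα₀ : 0 < α) (hα₁ : 0.917 ≤ 1 - α) :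
    3 ≤ zCrit (1 - α / 2) ^ 2 := by
  have h : 1.7325 < zCrit (1 - α / 2) := by
    refine lt_zCrit_of_sum_le (n := 9) (by decide) (by norm_num) hα₀ (by linarith) ?_
    norm_num [Finset.sum_range_succ, Nat.factorial]
    linarith
  nlinarith

lemma le_zCrit {α : ℝ} (hα₀ : 0 < α) (hα₁ : 0.9 ≤ 1 - α) : 1.6448 ≤ zCrit (1 - α / 2) := by
  refine (lt_zCrit_of_sum_le (n := 11) (by decide) (by norm_num) hα₀ (by linarith) ?_).le
  norm_num [Finset.sum_range_succ, Nat.factorial]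
  linarith

/-- The coverage probability of the interval with half-width `z` times the root mean squared error
around a normal estimator with bias `b` and standard deviation `s`. Equality of the mean squared
errors, `b² + s² = s₁²`, is parametrized by `|b| / s = sinh t` and `s₁ / s = cosh t`. -/
noncomputable def coverage (z t : ℝ) : ℝ :=
  Φ (z * cosh t + sinh t) + Φ (z * cosh t - sinh t) - 1

/-- The derivative of `coverage z`. -/
noncomputable def coverageDeriv (z t : ℝ) : ℝ :=
  2 * (φ z * exp (-((z ^ 2 + 1) / 2 * sinh t ^ 2))) *
    (z * sinh t * cosh (z * sinh t * cosh t) - cosh t * sinh (z * sinh t * cosh t))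

/-- The factor which governs the sign of the derivative of `coverage z` near zero, as a function of
`v = sinh² t`: the first three terms of a power series. -/
noncomputable def coverageSlope (z v : ℝ) : ℝ :=
  -1 + z ^ 2 * (1 + v) * (2 - v) / 6 + z ^ 4 * v * (1 + v) ^ 2 * (4 - v) / 120

lemma coverage_zero (z : ℝ) : coverage z 0 = 2 * Φ z - 1 := by
  simp [coverage, two_mul]

lemma coverage_lt_one (z t : ℝ) : coverage z t < 1 := by
  have hadd := cdf_gaussianReal_lt_one 0 one_ne_zero (z * cosh t + sinh t)
  have hsub := cdf_gaussianReal_lt_one 0 one_ne_zero (z * cosh t - sinh t)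
  unfold coverage
  linarith

lemma stdNormalPDF_cosh_add_sinh (z t : ℝ) :
    φ (z * cosh t + sinh t) = φ z * exp (-((z ^ 2 + 1) / 2 * sinh t ^ 2)) *
      exp (-(z * sinh t * cosh t)) := by
  rw [stdNormalPDF_eq, stdNormalPDF_eq, mul_assoc, mul_assoc, ← exp_add, ← exp_add]
  congr 2
  linear_combination (-z ^ 2 / 2) * cosh_sq t

lemma stdNormalPDF_cosh_sub_sinh (z t : ℝ) :
    φ (z * cosh t - sinh t) = φ z * exp (-((z ^ 2 + 1) / 2 * sinh t ^ 2)) *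
      exp (z * sinh t * cosh t) := by
  simpa [sub_eq_add_neg] using stdNormalPDF_cosh_add_sinh z (-t)

lemma hasDerivAt_coverage (z t : ℝ) : HasDerivAt (coverage z) (coverageDeriv z t) t := by
  have hcosh := (hasDerivAt_cosh t).const_mul z
  have hadd := (hasDerivAt_cdf_gaussianReal 0 one_ne_zero (z * cosh t + sinh t)).comp t
    (hcosh.add (hasDerivAt_sinh t))
  have hsub := (hasDerivAt_cdf_gaussianReal 0 one_ne_zero (z * cosh t - sinh t)).comp t
    (hcosh.sub (hasDerivAt_sinh t))
  refine ((hadd.add hsub).sub_const 1).congr_deriv ?_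
  rw [stdNormalPDF_cosh_add_sinh, stdNormalPDF_cosh_sub_sinh, coverageDeriv,
    cosh_eq (z * sinh t * cosh t), sinh_eq (z * sinh t * cosh t)]
  ring

lemma strictMonoOn_coverage_Ici {z t₀ : ℝ} (h : ∀ t, t₀ < t → 0 < coverageDeriv z t) :
    StrictMonoOn (coverage z) (Set.Ici t₀) :=
  strictMonoOn_of_hasDerivWithinAt_pos (convex_Ici t₀)
    (fun t _ => (hasDerivAt_coverage z t).continuousAt.continuousWithinAt)
    (fun t _ => (hasDerivAt_coverage z t).hasDerivWithinAt) fun t ht => h t (by simpa using ht)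

lemma coverageDeriv_pos {z t : ℝ} (hz : 0 < z) (ht : 0 ≤ t) (h : 1 ≤ (z ^ 2 - 1) * sinh t ^ 2) :
    0 < coverageDeriv z t := by
  have : 0 ≤ sinh t := sinh_nonneg_iff.2 ht
  have hle : cosh t ≤ z * sinh t :=
    le_of_sq_le_sq (by rw [cosh_sq]; linarith) (by positivity)
  have hpdf := gaussianPDFReal_pos 0 1 z one_ne_zero
  refine mul_pos (by positivity) (sub_pos.2 ?_)
  calc cosh t * sinh (z * sinh t * cosh t) < cosh t * cosh (z * sinh t * cosh t) :=
        mul_lt_mul_of_pos_left (sinh_lt_cosh _) (cosh_pos t)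
    _ ≤ z * sinh t * cosh (z * sinh t * cosh t) := mul_le_mul_of_nonneg_right hle (cosh_pos _).le

lemma strictMonoOn_coverage_Ici_of_one_le {z t₀ : ℝ} (hz : 1 < z) (ht₀ : 0 ≤ t₀)
    (h : 1 ≤ (z ^ 2 - 1) * sinh t₀ ^ 2) : StrictMonoOn (coverage z) (Set.Ici t₀) := by
  refine strictMonoOn_coverage_Ici fun t ht => coverageDeriv_pos (by linarith) (by linarith) ?_
  have : 0 ≤ sinh t₀ := sinh_nonneg_iff.2 ht₀
  have hst : sinh t₀ ≤ sinh t := sinh_le_sinh.2 ht.le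
  have hz' : 0 ≤ z ^ 2 - 1 := by nlinarith
  exact h.trans (by gcongr)

lemma sum_le_mul_cosh_sub_sinh (n : ℕ) {ρ y : ℝ} (hy : 0 ≤ y) (hρ : 1 ≤ (2 * n + 1) * ρ) :
    ∑ k ∈ Finset.range n, y ^ (2 * k + 1) / ((2 * k + 1).factorial : ℝ) * ((2 * k + 1) * ρ - 1) ≤
      ρ * y * cosh y - sinh y := by
  have hsum := ((hasSum_cosh y).mul_left (ρ * y)).sub (hasSum_sinh y)
  have hterm (k : ℕ) : ρ * y * (y ^ (2 * k) / ((2 * k).factorial : ℝ)) -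
      y ^ (2 * k + 1) / ((2 * k + 1).factorial : ℝ) =
      y ^ (2 * k + 1) / ((2 * k + 1).factorial : ℝ) * ((2 * k + 1) * ρ - 1) := by
    rw [Nat.factorial_succ]
    push_cast
    field_simp
    ring
  simp only [hterm] at hsum
  refine sum_le_hasSum _ (fun k hk => mul_nonneg (by positivity) (sub_nonneg.2 ?_)) hsum
  have hnk : (n : ℝ) ≤ k := by exact_mod_cast not_lt.1 (Finset.mem_range.not.1 hk)
  have hρ₀ : 0 ≤ ρ := le_of_not_gt fun hneg => by nlinarith [n.cast_nonneg (α := ℝ)]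
  exact hρ.trans (by gcongr)

lemma le_coverageDeriv {z t : ℝ} (hz : 0 < z) (ht : 0 ≤ t) (hv : sinh t ^ 2 ≤ 6) :
    2 * (φ z * exp (-((z ^ 2 + 1) / 2 * sinh t ^ 2))) *
      (z * sinh t ^ 3 * coverageSlope z (sinh t ^ 2)) ≤ coverageDeriv z t := by
  have : 0 ≤ sinh t := sinh_nonneg_iff.2 ht
  have hc := cosh_pos t
  have hc₂ := cosh_sq t
  have hpdf := gaussianPDFReal_pos 0 1 z one_ne_zero
  have hseries := sum_le_mul_cosh_sub_sinh 3 (ρ := 1 / cosh t ^ 2) (y := z * sinh t * cosh t)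
    (by positivity) (by rw [mul_one_div, one_le_div (by positivity)]; push_cast; linarith)
  unfold coverageDeriv
  gcongr 2 * _ * ?_
  calc z * sinh t ^ 3 * coverageSlope z (sinh t ^ 2)
      = cosh t * ∑ k ∈ Finset.range 3, (z * sinh t * cosh t) ^ (2 * k + 1) /
          ((2 * k + 1).factorial : ℝ) * ((2 * k + 1) * (1 / cosh t ^ 2) - 1) := by
        norm_num [coverageSlope, Finset.sum_range_succ, Nat.factorial]
        field_simp
        simp only [show cosh t ^ 4 = (cosh t ^ 2) ^ 2 by ring, hc₂]
        ring
    _ ≤ cosh t * (1 / cosh t ^ 2 * (z * sinh t * cosh t) * cosh (z * sinh t * cosh t) -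
          sinh (z * sinh t * cosh t)) := mul_le_mul_of_nonneg_left hseries hc.le
    _ = z * sinh t * cosh (z * sinh t * cosh t) - cosh t * sinh (z * sinh t * cosh t) := by
        field_simp

lemma coverageSlope_pos {z v : ℝ} (hz : 3 ≤ z ^ 2) (hv₀ : 0 < v) (hv₁ : v ≤ 1) :
    0 < coverageSlope z v := by
  have hquadratic : 3 * ((1 + v) * (2 - v)) ≤ z ^ 2 * ((1 + v) * (2 - v)) :=
    mul_le_mul_of_nonneg_right hz (mul_nonneg (by linarith) (by linarith))
  have hquartic : 0 < z ^ 4 * v * (1 + v) ^ 2 * (4 - v) := by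
    have hz₄ : 0 < z ^ 4 := by nlinarith
    have hv₄ : 0 < 4 - v := by linarith
    positivity
  unfold coverageSlope
  nlinarith

lemma strictMonoOn_coverage_of_three_le {z : ℝ} (hz : 0 < z) (hz₂ : 3 ≤ z ^ 2) :
    StrictMonoOn (coverage z) (Set.Ici 0) := by
  refine strictMonoOn_coverage_Ici fun t ht => ?_
  rcases le_total 1 (sinh t ^ 2) with hv | hv
  · exact coverageDeriv_pos hz ht.le (by nlinarith)
  · have hs : 0 < sinh t := sinh_pos_iff.2 ht
    have hslope := coverageSlope_pos hz₂ (pow_pos hs 2) hv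
    have hpdf := gaussianPDFReal_pos 0 1 z one_ne_zero
    exact lt_of_lt_of_le (by positivity) (le_coverageDeriv hz ht.le (by linarith))

lemma le_coverageSlope {z v : ℝ} (hz : 1.6448 ≤ z) (hv₀ : 0 ≤ v) (hv₁ : v ≤ 1) :
    0.693 * (v - 0.1418) ≤ coverageSlope z v := by
  have hz₂ : 2.7053 ≤ z ^ 2 := by nlinarith
  have hz₄ : 7.3186 ≤ z ^ 4 := by nlinarith
  have hquadratic : 2.7053 * ((1 + v) * (2 - v)) ≤ z ^ 2 * ((1 + v) * (2 - v)) :=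
    mul_le_mul_of_nonneg_right hz₂ (mul_nonneg (by linarith) (by linarith))
  have hquartic : 7.3186 * (v * (1 + v) ^ 2 * (4 - v)) ≤ z ^ 4 * (v * (1 + v) ^ 2 * (4 - v)) :=
    mul_le_mul_of_nonneg_right hz₄ (mul_nonneg (by positivity) (by linarith))
  have hremainder : 0 ≤ v * (0.0018 - 0.024 * v + 0.1219 * v ^ 2 - 0.061 * v ^ 3) := by
    refine mul_nonneg hv₀ ?_
    nlinarith [sq_nonneg (v - 0.13), mul_nonneg hv₀ (sub_nonneg.2 hv₁),
      mul_nonneg (sq_nonneg v) (sub_nonneg.2 hv₁), mul_nonneg hv₀ (sq_nonneg (v - 0.13))]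
  unfold coverageSlope
  nlinarith

lemma monotoneOn_coverage_Ici {z t₀ : ℝ} (hz : 1.6448 ≤ z) (ht₀ : 0 ≤ t₀)
    (hv₀ : 0.1418 ≤ sinh t₀ ^ 2) : MonotoneOn (coverage z) (Set.Ici t₀) := by
  refine monotoneOn_of_hasDerivWithinAt_nonneg (convex_Ici t₀)
    (fun t _ => (hasDerivAt_coverage z t).continuousAt.continuousWithinAt)
    (fun t _ => (hasDerivAt_coverage z t).hasDerivWithinAt) fun t ht => ?_
  have ht : t₀ ≤ t := interior_subset (s := Set.Ici t₀) ht
  have hz₀ : 0 < z := by linarith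
  have hs₀ : 0 ≤ sinh t₀ := sinh_nonneg_iff.2 ht₀
  have hst : sinh t₀ ≤ sinh t := sinh_le_sinh.2 ht
  rcases le_total 1 (sinh t ^ 2) with hv | hv
  · have hz₂ : 2 ≤ z ^ 2 := by nlinarith
    exact (coverageDeriv_pos hz₀ (ht₀.trans ht) (by nlinarith)).le
  · have hvt : sinh t₀ ^ 2 ≤ sinh t ^ 2 := by gcongr
    have hslope : 0 ≤ coverageSlope z (sinh t ^ 2) := by
      linarith [le_coverageSlope hz (sq_nonneg (sinh t)) hv]
    have : 0 ≤ sinh t := hs₀.trans hst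
    have hpdf := gaussianPDFReal_pos 0 1 z one_ne_zero
    exact le_trans (by positivity) (le_coverageDeriv hz₀ (ht₀.trans ht) (by linarith))

lemma le_exp_two_point_seven : 14.879 ≤ exp 2.7 := by
  refine le_of_pow_le_pow_left₀ (n := 10) (by norm_num) (exp_pos _).le ?_
  calc (14.879 : ℝ) ^ 10 ≤ 2.7182818283 ^ 27 := by norm_num
    _ ≤ exp 1 ^ 27 := by gcongr; exact exp_one_gt_d9.le
    _ = exp 2.7 ^ 10 := by rw [← exp_nat_mul, ← exp_nat_mul]; norm_num

lemma mul_le_exp {x : ℝ} (hx : 2.7 ≤ x) : 5.51 * x ≤ exp x := by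
  calc 5.51 * x ≤ 14.879 * (x - 2.7 + 1) := by linarith
    _ ≤ exp 2.7 * exp (x - 2.7) :=
      mul_le_mul le_exp_two_point_seven (add_one_le_exp _) (by linarith) (exp_pos _).le
    _ = exp x := by rw [← exp_add, add_sub_cancel]

lemma mul_stdNormalPDF_le {z : ℝ} (hz : 1.6448 ≤ z) : z * φ z ≤ 0.17 := by
  refine le_of_sq_le_sq ?_ (by norm_num)
  rw [stdNormalPDF_eq, mul_pow, mul_pow, inv_pow, sq_sqrt (by positivity), ← exp_nat_mul,
    show ((2 : ℕ) : ℝ) * (-z ^ 2 / 2) = -z ^ 2 by push_cast; ring, exp_neg, ← mul_inv,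
    ← div_eq_mul_inv, div_le_iff₀ (by positivity)]
  have hπ := pi_gt_d4
  have hmul : 2 * 3.1415 * (5.51 * z ^ 2) ≤ 2 * π * exp (z ^ 2) := by
    gcongr
    exact mul_le_exp (by nlinarith)
  linarith [sq_nonneg z]

lemma exp_neg_le {z v : ℝ} (hz : 1.6448 ≤ z) (hv₀ : 0 ≤ v) (hv₁ : v ≤ 0.1418) :
    exp (-((z ^ 2 + 1) / 2 * v)) ≤ 1 - 1.6 * v := by
  have hz₂ : 2.7 ≤ z ^ 2 := by nlinarith
  have hexp : 1 + 1.85 * v + (1.85 * v) ^ 2 / 2 ≤ exp ((z ^ 2 + 1) / 2 * v) :=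
    (quadratic_le_exp_of_nonneg (by positivity)).trans (exp_le_exp.2 (by nlinarith))
  rw [exp_neg, inv_le_iff_one_le_mul₀ (exp_pos _)]
  nlinarith [mul_nonneg hv₀ (sub_nonneg.2 hv₁)]

/-- A polynomial minorant of `coverage z t - coverage z 0`, as a function of `v = sinh² t`: it
integrates the lower bound for the derivative which results from replacing `z * φ z` by `0.17`, the
exponential factor by `1 - 1.6 * v` and `coverageSlope z v` by `0.693 * (v - 0.1418)`. -/
noncomputable def coverageMinorant (v : ℝ) : ℝ :=
  0.11781 * (-0.0709 * v ^ 2 + 0.40896 * v ^ 3 - 0.4 * v ^ 4)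

lemma hasDerivAt_coverageMinorant (v : ℝ) : HasDerivAt coverageMinorant
    (0.17 * (1 - 1.6 * v) * (0.693 * (v * (v - 0.1418)))) v := by
  have hpow (n : ℕ) (c : ℝ) := (hasDerivAt_pow n v).const_mul c
  refine ((((hpow 2 (-0.0709)).add (hpow 3 0.40896)).sub (hpow 4 0.4)).const_mul
    0.11781).congr_deriv ?_
  norm_num
  ring

lemma le_coverageMinorant {v : ℝ} (hv₀ : 0 ≤ v) (hv₁ : v ≤ 0.1418) :
    -0.00005 ≤ coverageMinorant v := by
  have hfactor : 0 ≤ (v - 0.1418) ^ 2 * (0.02095 + 0.2955 * v - 0.4 * v ^ 2) :=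
    mul_nonneg (sq_nonneg _) (by nlinarith)
  unfold coverageMinorant
  nlinarith

lemma deriv_coverageMinorant_comp_le_coverageDeriv {z t : ℝ} (hz : 1.6448 ≤ z) (ht : 0 ≤ t)
    (hv : sinh t ^ 2 ≤ 0.1418) :
    0.17 * (1 - 1.6 * sinh t ^ 2) * (0.693 * (sinh t ^ 2 * (sinh t ^ 2 - 0.1418))) *
      (2 * sinh t * cosh t) ≤ coverageDeriv z t := by
  have : 0 ≤ sinh t := sinh_nonneg_iff.2 ht
  have hv₀ := sq_nonneg (sinh t)
  have hslope := le_coverageSlope hz hv₀ (by linarith)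
  have hpdf := gaussianPDFReal_pos 0 1 z one_ne_zero
  have hz₀ : 0 < z := by linarith
  set w := z * φ z * exp (-((z ^ 2 + 1) / 2 * sinh t ^ 2)) with hw
  have hw₀ : 0 ≤ w := by positivity
  have hw₁ : w ≤ 0.17 * (1 - 1.6 * sinh t ^ 2) :=
    mul_le_mul (mul_stdNormalPDF_le hz) (exp_neg_le hz hv₀ hv) (exp_pos _).le (by norm_num)
  have hroot : 0.693 * (sinh t ^ 2 - 0.1418) ≤ 0 := by linarith
  have hmul := mul_le_mul_of_nonpos_right hw₁ hroot
  have hmul₀ := mul_nonpos_of_nonneg_of_nonpos hw₀ hroot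
  calc 0.17 * (1 - 1.6 * sinh t ^ 2) * (0.693 * (sinh t ^ 2 * (sinh t ^ 2 - 0.1418))) *
        (2 * sinh t * cosh t)
      = 2 * sinh t ^ 3 * (cosh t * (0.17 * (1 - 1.6 * sinh t ^ 2) *
          (0.693 * (sinh t ^ 2 - 0.1418)))) := by ring
    _ ≤ 2 * sinh t ^ 3 * (w * coverageSlope z (sinh t ^ 2)) := by
        gcongr 2 * sinh t ^ 3 * ?_
        exact (mul_le_of_one_le_left (hmul.trans hmul₀) (one_le_cosh t)).trans
          (hmul.trans (mul_le_mul_of_nonneg_left hslope hw₀))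
    _ = 2 * (φ z * exp (-((z ^ 2 + 1) / 2 * sinh t ^ 2))) *
          (z * sinh t ^ 3 * coverageSlope z (sinh t ^ 2)) := by rw [hw]; ring
    _ ≤ coverageDeriv z t := le_coverageDeriv hz₀ ht (by linarith)

lemma monotoneOn_coverage_sub_coverageMinorant {z t₀ : ℝ} (hz : 1.6448 ≤ z)
    (hv₀ : sinh t₀ ^ 2 ≤ 0.1418) :
    MonotoneOn (fun t => coverage z t - coverageMinorant (sinh t ^ 2)) (Set.Icc 0 t₀) := by
  have hderiv (t : ℝ) := (hasDerivAt_coverage z t).sub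
    ((hasDerivAt_coverageMinorant (sinh t ^ 2)).comp t ((hasDerivAt_sinh t).pow 2))
  refine monotoneOn_of_hasDerivWithinAt_nonneg (convex_Icc 0 t₀)
    (fun t _ => (hderiv t).continuousAt.continuousWithinAt)
    (fun t _ => (hderiv t).hasDerivWithinAt) fun t ht => ?_
  obtain ⟨ht₀, ht₁⟩ := interior_subset (s := Set.Icc 0 t₀) ht
  have : 0 ≤ sinh t := sinh_nonneg_iff.2 ht₀
  have hst : sinh t ≤ sinh t₀ := sinh_le_sinh.2 ht₁
  have hv : sinh t ^ 2 ≤ 0.1418 := le_trans (by gcongr) hv₀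
  simpa using deriv_coverageMinorant_comp_le_coverageDeriv hz ht₀ hv

lemma coverage_zero_sub_le_of_sinh_sq_le {z t : ℝ} (hz : 1.6448 ≤ z) (ht : 0 ≤ t)
    (hv : sinh t ^ 2 ≤ 0.1418) : coverage z 0 - 0.00005 ≤ coverage z t := by
  have hmono := monotoneOn_coverage_sub_coverageMinorant hz hv
    (Set.left_mem_Icc.2 ht) (Set.right_mem_Icc.2 ht) ht
  have hminorant := le_coverageMinorant (sq_nonneg (sinh t)) hv
  norm_num [coverageMinorant] at hmono hminorant
  linarith

lemma coverage_zero_sub_le {z t : ℝ} (hz : 1.6448 ≤ z) (ht : 0 ≤ t) :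
    coverage z 0 - 0.00005 ≤ coverage z t := by
  have hsinh : sinh (arsinh √0.1418) ^ 2 = 0.1418 := by
    rw [sinh_arsinh, sq_sqrt (by norm_num)]
  have harsinh : 0 ≤ arsinh √0.1418 := arsinh_nonneg_iff.2 (sqrt_nonneg _)
  rcases le_total (arsinh √0.1418) t with h | h
  · exact (coverage_zero_sub_le_of_sinh_sq_le hz harsinh hsinh.le).trans
      (monotoneOn_coverage_Ici hz harsinh hsinh.ge Set.self_mem_Ici h h)
  · have : 0 ≤ sinh t := sinh_nonneg_iff.2 ht
    have hst : sinh t ≤ sinh (arsinh √0.1418) := sinh_le_sinh.2 h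
    exact coverage_zero_sub_le_of_sinh_sq_le hz ht (le_trans (by gcongr) hsinh.le)

namespace EqualMSEModel

variable {θ s₁ : ℝ} (M : EqualMSEModel.{u} θ s₁)

lemma abs_b₂_le (hs₁ : 0 < s₁) : |M.b₂| ≤ s₁ :=
  abs_le_of_sq_le_sq (by linarith [M.equal_mse, sq_nonneg M.s₂]) hs₁.le

lemma CP₁_eq (hs₁ : 0 < s₁) {α : ℝ} (hα₀ : 0 < α) (hα₁ : α < 1) : M.CP₁ α = 1 - α := by
  have hz := zCrit_pos hα₀ hα₁
  calc M.CP₁ α = Φ ((zCrit (1 - α / 2) * s₁ + (θ - θ)) / s₁) +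
          Φ ((zCrit (1 - α / 2) * s₁ - (θ - θ)) / s₁) - 1 :=
        coverageProb_Icc_of_normalDist M.law₁ hs₁ (by positivity) θ
    _ = 2 * Φ (zCrit (1 - α / 2)) - 1 := by
        rw [sub_self, add_zero, sub_zero, mul_div_cancel_right₀ _ hs₁.ne', two_mul]
    _ = 1 - α := by
        rw [cdf_stdNormal_zCrit hα₀ hα₁]
        ring

lemma cosh_arsinh_abs_b₂_div_s₂ (hs₁ : 0 < s₁) (hs₂ : 0 < M.s₂) :
    cosh (arsinh (|M.b₂| / M.s₂)) = s₁ / M.s₂ := by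
  have hsq : 1 + (|M.b₂| / M.s₂) ^ 2 = (s₁ / M.s₂) ^ 2 := by
    rw [div_pow, div_pow, sq_abs, ← M.equal_mse]
    field_simp
    ring
  rw [cosh_arsinh, hsq, sqrt_sq (by positivity)]

lemma CP₂_eq_coverage (hs₁ : 0 < s₁) {α : ℝ} (hα₀ : 0 < α) (hα₁ : α < 1) (hs₂ : 0 < M.s₂) :
    M.CP₂ α = coverage (zCrit (1 - α / 2)) (arsinh (|M.b₂| / M.s₂)) := by
  have hz := zCrit_pos hα₀ hα₁
  have hlaw : M.CP₂ α = Φ ((zCrit (1 - α / 2) * s₁ + (θ + M.b₂ - θ)) / M.s₂) +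
      Φ ((zCrit (1 - α / 2) * s₁ - (θ + M.b₂ - θ)) / M.s₂) - 1 :=
    coverageProb_Icc_of_normalDist M.law₂ hs₂ (by positivity) θ
  rw [hlaw, add_sub_cancel_left, add_div, sub_div, mul_div_assoc,
    ← M.cosh_arsinh_abs_b₂_div_s₂ hs₁ hs₂, coverage, sinh_arsinh]
  rcases abs_choice M.b₂ with hb | hb
  · rw [hb]
  · rw [hb, neg_div, sub_neg_eq_add, ← sub_eq_add_neg, add_comm (Φ _)]

lemma one_sub_le_CP₂ (hs₁ : 0 < s₁) {α : ℝ} (hz : 1 < zCrit (1 - α / 2)) :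
    1 - (s₁ ^ 2 - |M.b₂| ^ 2) / (zCrit (1 - α / 2) * s₁ - |M.b₂|) ^ 2 ≤ M.CP₂ α := by
  have hmean : M.P[M.est₂] = θ + M.b₂ := by
    rw [M.law₂.integral_eq, normalDist, integral_id_gaussianReal]
  have hvar : Var[M.est₂; M.P] = s₁ ^ 2 - |M.b₂| ^ 2 := by
    rw [M.law₂.variance_eq, normalDist, variance_id_gaussianReal, coe_toNNReal _ (sq_nonneg _),
      sq_abs, ← M.equal_mse, add_sub_cancel_left]
  have hbias : |M.P[M.est₂] - θ| = |M.b₂| := by rw [hmean, add_sub_cancel_left]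
  have hmem : MemLp M.est₂ 2 M.P := by
    have hid : MemLp id 2 (normalDist (θ + M.b₂) M.s₂) := memLp_id_gaussianReal 2
    rw [← M.law₂.map_eq] at hid
    exact hid.comp_of_map M.law₂.aemeasurable
  have hlt : |M.P[M.est₂] - θ| < zCrit (1 - α / 2) * s₁ := by
    rw [hbias]
    exact (M.abs_b₂_le hs₁).trans_lt (lt_mul_of_one_lt_left hs₁ hz)
  have h := one_sub_variance_div_sq_le_coverageProb hmem hlt
  rwa [hvar, hbias] at h

lemma CP₂_le_one (α : ℝ) : M.CP₂ α ≤ 1 :=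
  measureReal_le_one

lemma CP₂_eq_one (hs₁ : 0 < s₁) {α : ℝ} (hz : 1 < zCrit (1 - α / 2)) (hs₂ : M.s₂ = 0) :
    M.CP₂ α = 1 := by
  have hmse : s₁ ^ 2 - |M.b₂| ^ 2 = 0 := by
    rw [sq_abs, ← M.equal_mse, hs₂]
    ring
  have h := M.one_sub_le_CP₂ hs₁ hz
  rw [hmse, zero_div, sub_zero] at h
  exact le_antisymm (M.CP₂_le_one α) h

lemma one_sub_lt_CP₂ (hs₁ : 0 < s₁) {α : ℝ} (hα₀ : 0 < α) (hα₁ : 0.917 ≤ 1 - α)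
    (hb₂ : M.b₂ ≠ 0) : 1 - α < M.CP₂ α := by
  rcases M.s₂_nonneg.eq_or_lt' with hs₂ | hs₂
  · rw [M.CP₂_eq_one hs₁ (one_lt_zCrit hα₀ (by linarith)) hs₂]
    linarith
  · have ht : 0 < arsinh (|M.b₂| / M.s₂) := arsinh_pos_iff.2 (by positivity)
    have hmono := strictMonoOn_coverage_of_three_le (zCrit_pos hα₀ (by linarith))
      (three_le_sq_zCrit hα₀ hα₁) Set.self_mem_Ici ht.le ht
    rw [coverage_zero, cdf_stdNormal_zCrit hα₀ (by linarith)] at hmono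
    rw [M.CP₂_eq_coverage hs₁ hα₀ (by linarith) hs₂]
    linarith

lemma one_sub_sub_le_CP₂ (hs₁ : 0 < s₁) {α : ℝ} (hα₀ : 0 < α) (hα₁ : 0.9 ≤ 1 - α) :
    1 - α - 0.00005 ≤ M.CP₂ α := by
  rcases M.s₂_nonneg.eq_or_lt' with hs₂ | hs₂
  · rw [M.CP₂_eq_one hs₁ (one_lt_zCrit hα₀ (by linarith)) hs₂]
    linarith
  · have hle := coverage_zero_sub_le (t := arsinh (|M.b₂| / M.s₂)) (le_zCrit hα₀ hα₁)
      (arsinh_nonneg_iff.2 (by positivity))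
    rw [coverage_zero, cdf_stdNormal_zCrit hα₀ (by linarith)] at hle
    rw [M.CP₂_eq_coverage hs₁ hα₀ (by linarith) hs₂]
    linarith

lemma tendsto_CP₂ (hs₁ : 0 < s₁) {α : ℝ} (hz : 1 < zCrit (1 - α / 2)) :
    Tendsto (fun M : EqualMSEModel.{u} θ s₁ => M.CP₂ α)
      (comap (fun M : EqualMSEModel.{u} θ s₁ => |M.b₂|) (𝓝 s₁)) (𝓝 1) := by
  have hbound : Tendsto (fun b => 1 - (s₁ ^ 2 - b ^ 2) / (zCrit (1 - α / 2) * s₁ - b) ^ 2)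
      (𝓝 s₁) (𝓝 1) := by
    have hne : (zCrit (1 - α / 2) * s₁ - s₁) ^ 2 ≠ 0 := by
      have := lt_mul_of_one_lt_left hs₁ hz
      exact pow_ne_zero 2 (by linarith)
    have hcont : ContinuousAt
        (fun b => 1 - (s₁ ^ 2 - b ^ 2) / (zCrit (1 - α / 2) * s₁ - b) ^ 2) s₁ := by
      fun_prop (disch := exact hne)
    simpa using hcont.tendsto
  exact tendsto_of_tendsto_of_tendsto_of_le_of_le (hbound.comp tendsto_comap) tendsto_const_nhds
    (fun M => M.one_sub_le_CP₂ hs₁ hz) fun M => M.CP₂_le_one α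

variable {M} {M' : EqualMSEModel.{u} θ s₁}

lemma s₂_lt_s₂ (hlt : |M.b₂| < |M'.b₂|) : M'.s₂ < M.s₂ := by
  have hsq : M.b₂ ^ 2 < M'.b₂ ^ 2 := sq_lt_sq.2 hlt
  exact lt_of_pow_lt_pow_left₀ 2 M.s₂_nonneg (by linarith [M.equal_mse, M'.equal_mse])

lemma CP₂_lt_CP₂ (hs₁ : 0 < s₁) {α : ℝ} (hα₀ : 0 < α) (hα₁ : α < 1)
    (hz : 1 < zCrit (1 - α / 2)) (hβ : s₁ / zCrit (1 - α / 2) ≤ |M.b₂|)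
    (hlt : |M.b₂| < |M'.b₂|) : M.CP₂ α < M'.CP₂ α := by
  have hs₂ : 0 < M.s₂ := M'.s₂_nonneg.trans_lt (s₂_lt_s₂ hlt)
  rw [M.CP₂_eq_coverage hs₁ hα₀ hα₁ hs₂]
  rcases M'.s₂_nonneg.eq_or_lt' with hs₂' | hs₂'
  · rw [M'.CP₂_eq_one hs₁ hz hs₂']
    exact coverage_lt_one _ _
  rw [M'.CP₂_eq_coverage hs₁ hα₀ hα₁ hs₂']
  have harsinh : arsinh (|M.b₂| / M.s₂) < arsinh (|M'.b₂| / M'.s₂) :=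
    arsinh_lt_arsinh.2 (div_lt_div₀ hlt (s₂_lt_s₂ hlt).le (abs_nonneg _) hs₂')
  have hone_le : 1 ≤ (zCrit (1 - α / 2) ^ 2 - 1) * sinh (arsinh (|M.b₂| / M.s₂)) ^ 2 := by
    have hle : s₁ ^ 2 ≤ (|M.b₂| * zCrit (1 - α / 2)) ^ 2 :=
      pow_le_pow_left₀ hs₁.le ((div_le_iff₀ (by linarith)).1 hβ) 2
    rw [mul_pow, sq_abs, ← M.equal_mse] at hle
    rw [sinh_arsinh, div_pow, sq_abs, ← mul_div_assoc, one_le_div (by positivity)]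
    linarith
  exact strictMonoOn_coverage_Ici_of_one_le hz (arsinh_nonneg_iff.2 (by positivity)) hone_le
    Set.self_mem_Ici harsinh.le harsinh

end EqualMSEModel

theorem theorem1_general (θ s₁ : ℝ) (hs₁ : 0 < s₁) :
    (∀ α : ℝ, 0 < α → α < 1 → ∀ M : EqualMSEModel.{u} θ s₁, M.CP₁ α = 1 - α) ∧
    (∀ α : ℝ, 0 < α → 0.917 ≤ 1 - α → ∀ M : EqualMSEModel.{u} θ s₁,
      M.b₂ ≠ 0 → 1 - α < M.CP₂ α) ∧
    (∀ α : ℝ, 0 < α → 0.9 ≤ 1 - α → ∀ M : EqualMSEModel.{u} θ s₁,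
      1 - α - 0.00005 ≤ M.CP₂ α) ∧
    ∀ α : ℝ, 0 < α → 0.683 ≤ 1 - α →
      Tendsto (fun M : EqualMSEModel.{u} θ s₁ => M.CP₂ α)
        (comap (fun M : EqualMSEModel.{u} θ s₁ => |M.b₂|) (𝓝 s₁)) (𝓝 1) ∧
      ∃ β < s₁, ∀ M M' : EqualMSEModel.{u} θ s₁,
        β ≤ |M.b₂| → |M.b₂| < |M'.b₂| → M.CP₂ α < M'.CP₂ α := by
  refine ⟨fun α hα₀ hα₁ M => M.CP₁_eq hs₁ hα₀ hα₁,
    fun α hα₀ hα₁ M => M.one_sub_lt_CP₂ hs₁ hα₀ hα₁,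
    fun α hα₀ hα₁ M => M.one_sub_sub_le_CP₂ hs₁ hα₀ hα₁, fun α hα₀ hα₁ => ?_⟩
  have hz : 1 < zCrit (1 - α / 2) := one_lt_zCrit hα₀ hα₁
  exact ⟨EqualMSEModel.tendsto_CP₂ hs₁ hz, s₁ / zCrit (1 - α / 2), div_lt_self hs₁ hz,
    fun M M' => EqualMSEModel.CP₂_lt_CP₂ hs₁ hα₀ (by linarith) hz⟩

theorem theorem1 (θ s₁ : ℝ) (hs₁ : 0 < s₁) :
    -- the benchmark interval has exact coverage
    (∀ α : ℝ, 0 < α → α < 1 → ∀ M : EqualMSEModel.{u} θ s₁, M.CP₁ α = 1 - α) ∧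
    -- at levels of at least 0.917, coverage is strictly above nominal under nonzero bias
    (∀ α : ℝ, 0 < α → 0.917 ≤ 1 - α → ∀ M : EqualMSEModel.{u} θ s₁,
      M.b₂ ≠ 0 → 1 - α < M.CP₂ α) ∧
    -- at level 0.9, coverage is at least 90.00% (rounded), for any bias
    (∀ M : EqualMSEModel.{u} θ s₁, 0.89995 ≤ M.CP₂ 0.1) ∧
    -- at level 0.9, coverage tends to 1 as |b₂| → s₁ ...
    Tendsto (fun M : EqualMSEModel.{u} θ s₁ => M.CP₂ 0.1)
      (comap (fun M : EqualMSEModel.{u} θ s₁ => |M.b₂|) (𝓝 s₁)) (𝓝 1) ∧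
    -- ... and does so increasingly
    (∃ β < s₁, ∀ M M' : EqualMSEModel.{u} θ s₁,
      β ≤ |M.b₂| → |M.b₂| < |M'.b₂| → M.CP₂ 0.1 < M'.CP₂ 0.1) := by
  obtain ⟨hCP₁, hstrict, hrounded, hnear⟩ := theorem1_general θ s₁ hs₁
  refine ⟨hCP₁, hstrict, fun M => ?_, hnear 0.1 (by norm_num) (by norm_num)⟩
  linarith [hrounded 0.1 (by norm_num) (by norm_num) M]
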